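/- Let $\kappa$ be an algebraically closed field of characteristic zero and let $X$ be a nonsingular projective variety over $\kappa$ of dimension $n\ge 2$. Let $\mathcal E$ and $\mathcal F$ be vector bundles on $X$ (locally free sheaves of finite rank) such that 1. $\mathcal E$ and $\mathcal F$ are simple, i.e. $\mathrm{Hom}(\mathcal E,\mathcal E)=\mathrm{Hom}(\mathcal F,\mathcal F)=\kappa$; 2. $\mathrm{Hom}(\mathcal F,\mathcal E)=0$; 3. $\mathrm{Ext}^1(\mathcal F,\mathcal E)=0$; 4. the sheaf $\mathcal E^\vee\otimes\mathcal F$ is globally generated; 5. $w:=\dim_\kappa\mathrm{Hom}(\mathcal E,\mathcal F)\ge 3$. Let $a,b\ge 0$ be integers with $b\cdot\mathrm{rk}(\mathcal F)-a\cdot\mathrm{rk}(\mathcal E)\ge n$, and let $\mathcal C$ be a cokernel bundle of type $(\mathcal E,\mathcal F)$ with these exponents, i.e. a vector bundle on $X$ that fits into a short exact sequence $$0\longrightarrow \mathcal E^{a}\longrightarrow \mathcal F^{b}\longrightarrow \mathcal C\longrightarrow 0 .$$ If $\mathcal C$ is exceptional, i.e. $\mathrm{Hom}(\mathcal C,\mathcal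 C)=\kappa$ and $\mathrm{Ext}^p(\mathcal C,\mathcal C)=0$ for all $p\ge 1$, then $$a^2+b^2-w\,a\,b=1 .$$ -/

import Mathlib

open CategoryTheory Limits AlgebraicGeometry

universe u

noncomputable section

namespace CokernelBundles

attribute [local instance] Abelian.hasFiniteBiproducts MvPolynomial.gradedAlgebra

/-! ### Nonsingular projective varieties over a field -/

section Varieties

variable (κ : Type u) [Field κ]

/-- Projective space `ℙ^N` over `κ`, as the `Proj` of `κ[x₀, …, x_N]` with its standard grading. -/
abbrev projectiveSpace (N : ℕ) : Scheme.{u} :=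
  Proj (MvPolynomial.homogeneousSubmodule (Fin (N + 1)) κ)

/-- The structure morphism `ℙ^N ⟶ Spec κ`. -/
def projectiveSpaceToSpec (N : ℕ) : projectiveSpace κ N ⟶ Spec (.of κ) :=
  Proj.toSpecZero (MvPolynomial.homogeneousSubmodule (Fin (N + 1)) κ) ≫
    Spec.map (CommRingCat.ofHom
      (algebraMap κ (MvPolynomial.homogeneousSubmodule (Fin (N + 1)) κ 0)))

/-- `X` is a nonsingular projective variety over `κ`: an integral scheme that is isomorphic over
`κ` to a closed subscheme of some `ℙ^N` and all of whose local rings are regular. -/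
structure IsNonsingularProjectiveVariety (X : Scheme.{u}) [X.Over (Spec (.of κ))] : Prop where
  isIntegral : IsIntegral X
  projective : ∃ (N : ℕ) (i : X ⟶ projectiveSpace κ N),
    IsClosedImmersion i ∧ i ≫ projectiveSpaceToSpec κ N = X ↘ Spec (.of κ)
  nonsingular : ∀ x : X, IsRegularLocalRing (X.presheaf.stalk x)

end Varieties

/-! ### The `κ`-linear structure on the category of `𝒪_X`-modules -/

section Linear

variable {X : Scheme.{u}}

/-- Multiplication by a global function `r` on an `𝒪_X`-module. -/
def globalSMul (r : Γ(X, ⊤)) (M : X.Modules) : M ⟶ M where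
  val :=
    { app := fun U => ModuleCat.ofHom (X := M.val.obj U) (Y := M.val.obj U)
        { toFun := fun x =>
            (X.presheaf.map (homOfLE (le_top : U.unop ≤ ⊤)).op r : Γ(X, U.unop)) •
              (show Γ(M, U.unop) from x)
          map_add' := fun x y => smul_add (A := Γ(M, U.unop)) _ x y
          map_smul' := fun s x =>
            smul_comm (M := Γ(X, U.unop)) (N := Γ(X, U.unop)) (α := Γ(M, U.unop)) _ s x }
      naturality := fun {U V} f => by
        ext x
        have h := M.map_smul f.unop (X.presheaf.map (homOfLE (le_top : U.unop ≤ ⊤)).op r) x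
        have h2 : X.presheaf.map f (X.presheaf.map (homOfLE (le_top : U.unop ≤ ⊤)).op r) =
            X.presheaf.map (homOfLE (le_top : V.unop ≤ ⊤)).op r := by
          rw [← CategoryTheory.comp_apply, ← Functor.map_comp]
          rfl
        exact ((congrArg (fun t : Γ(X, V.unop) => t • (show Γ(M, V.unop) from M.presheaf.map f x))
          h2).symm.trans h.symm) }

lemma globalSMul_app (r : Γ(X, ⊤)) (M : X.Modules) (U : X.Opens) (x : Γ(M, U)) :
    (globalSMul r M).app U x = (X.presheaf.map (homOfLE (le_top : U ≤ ⊤)).op r : Γ(X, U)) • x :=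
  rfl

/-- The ring morphism from the global functions on `X` to the center of the category of
`𝒪_X`-modules. -/
def globalToCenter (X : Scheme.{u}) : Γ(X, ⊤) →+* CatCenter X.Modules where
  toFun r :=
    { app := fun M => globalSMul r M
      naturality := fun M N f => by
        ext U x
        exact (f.app_smul (X.presheaf.map (homOfLE (le_top : U ≤ ⊤)).op r) x).symm }
  map_one' := by
    ext M U x
    change (X.presheaf.map (homOfLE (le_top : U ≤ ⊤)).op 1 : Γ(X, U)) • x = x
    rw [map_one, one_smul]
  map_mul' r s := by
    ext M U x
    change (X.presheaf.map (homOfLE (le_top : U ≤ ⊤)).op (r * s) : Γ(X, U)) • x =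
      (X.presheaf.map (homOfLE (le_top : U ≤ ⊤)).op r : Γ(X, U)) •
        (X.presheaf.map (homOfLE (le_top : U ≤ ⊤)).op s : Γ(X, U)) • x
    rw [map_mul, mul_smul]
  map_zero' := by
    ext M U x
    change (X.presheaf.map (homOfLE (le_top : U ≤ ⊤)).op 0 : Γ(X, U)) • x = 0
    rw [map_zero, zero_smul]
  map_add' r s := by
    ext M U x
    change (X.presheaf.map (homOfLE (le_top : U ≤ ⊤)).op (r + s) : Γ(X, U)) • x =
      (X.presheaf.map (homOfLE (le_top : U ≤ ⊤)).op r : Γ(X, U)) • x +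
        (X.presheaf.map (homOfLE (le_top : U ≤ ⊤)).op s : Γ(X, U)) • x
    rw [map_add, add_smul]

variable (κ : Type u) [Field κ] [X.Over (Spec (.of κ))]

/-- The scalars `κ ⟶ Γ(X, 𝒪_X)` of a `κ`-scheme `X`. -/
def scalars : κ →+* Γ(X, ⊤) :=
  (X ↘ Spec (.of κ)).appTop.hom.comp (Scheme.ΓSpecIso (.of κ)).inv.hom

/-- For a `κ`-scheme `X`, the category of `𝒪_X`-modules is `κ`-linear: a scalar acts on a
morphism through its action on sections. -/
instance : Linear κ X.Modules :=
  Linear.ofRingMorphism ((globalToCenter X).comp (scalars κ))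

end Linear

/-! ### Vector bundles, duals, tensor products, global generation -/

section Modules

variable {X : Scheme.{u}}

/-- `M` is a vector bundle of rank `r`: it is locally isomorphic to `𝒪^r`. -/
def IsVectorBundleOfRank (M : X.Modules) (r : ℕ) : Prop :=
  ∀ x : X, ∃ U : X.Opens, x ∈ U ∧
    Nonempty (M.restrict U.ι ≅
      (SheafOfModules.free (ULift.{u} (Fin r)) : SheafOfModules (U : Scheme.{u}).ringCatSheaf))

/-- The sections over `U` of the dual `M^∨ = ℋom(M, 𝒪_X)`: the morphisms `M|_U ⟶ 𝒪_U`, that is,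
the families of `𝒪(V)`-linear maps `M(V) ⟶ 𝒪(V)`, for `V ⊆ U` open, which are compatible with
restriction. -/
def dualSections (M : X.Modules) (U : X.Opens) :
    AddSubgroup (∀ V : {V : X.Opens // V ≤ U}, Γ(M, V.1) →ₗ[Γ(X, V.1)] Γ(X, V.1)) where
  carrier := {φ | ∀ (V W : {V : X.Opens // V ≤ U}) (h : W.1 ≤ V.1) (x : Γ(M, V.1)),
    φ W (M.presheaf.map (homOfLE h).op x) = X.presheaf.map (homOfLE h).op (φ V x)}
  zero_mem' := fun V W h x => by simp
  add_mem' := fun {φ ψ} hφ hψ V W h x => by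
    simp [hφ V W h x, hψ V W h x]
  neg_mem' := fun {φ} hφ V W h x => by
    simp [hφ V W h x]

/-- `Γ(X, U)` acts on the sections of the dual over `U` by multiplication of the values. -/
instance (M : X.Modules) (U : X.Opens) : Module Γ(X, U) (dualSections M U) where
  smul r φ := ⟨fun V => (X.presheaf.map (homOfLE V.2).op r : Γ(X, V.1)) • φ.1 V,
    fun V W h x => by
      have h2 : X.presheaf.map (homOfLE h).op (X.presheaf.map (homOfLE V.2).op r) =
          X.presheaf.map (homOfLE W.2).op r := by
        rw [← CategoryTheory.comp_apply, ← Functor.map_comp]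
        rfl
      simp [φ.2 V W h x, h2]⟩
  one_smul φ := by
    ext V x
    change (X.presheaf.map (homOfLE V.2).op 1 : Γ(X, V.1)) • φ.1 V x = φ.1 V x
    rw [map_one, one_smul]
  mul_smul r s φ := by
    ext V x
    change (X.presheaf.map (homOfLE V.2).op (r * s) : Γ(X, V.1)) • φ.1 V x =
      (X.presheaf.map (homOfLE V.2).op r : Γ(X, V.1)) •
        (X.presheaf.map (homOfLE V.2).op s : Γ(X, V.1)) • φ.1 V x
    rw [map_mul, mul_smul]
  smul_zero r := by
    ext V x
    change (X.presheaf.map (homOfLE V.2).op r : Γ(X, V.1)) • (0 : Γ(X, V.1)) = 0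
    rw [smul_zero]
  smul_add r φ ψ := by
    ext V x
    change (X.presheaf.map (homOfLE V.2).op r : Γ(X, V.1)) • (φ.1 V x + ψ.1 V x) =
      (X.presheaf.map (homOfLE V.2).op r : Γ(X, V.1)) • φ.1 V x +
        (X.presheaf.map (homOfLE V.2).op r : Γ(X, V.1)) • ψ.1 V x
    rw [smul_add]
  add_smul r s φ := by
    ext V x
    change (X.presheaf.map (homOfLE V.2).op (r + s) : Γ(X, V.1)) • φ.1 V x =
      (X.presheaf.map (homOfLE V.2).op r : Γ(X, V.1)) • φ.1 V x +
        (X.presheaf.map (homOfLE V.2).op s : Γ(X, V.1)) • φ.1 V x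
    rw [map_add, add_smul]
  zero_smul φ := by
    ext V x
    change (X.presheaf.map (homOfLE V.2).op 0 : Γ(X, V.1)) • φ.1 V x = 0
    rw [map_zero, zero_smul]

/-- Restriction of sections of the dual. -/
def dualRestrict (M : X.Modules) {U W : X.Opens} (h : W ≤ U) :
    dualSections M U →+ dualSections M W where
  toFun φ := ⟨fun V => φ.1 ⟨V.1, V.2.trans h⟩, fun V V' h' x =>
    φ.2 ⟨V.1, V.2.trans h⟩ ⟨V'.1, V'.2.trans h⟩ h' x⟩
  map_zero' := rfl
  map_add' _ _ := rfl

lemma dualRestrict_smul (M : X.Modules) {U W : X.Opens} (h : W ≤ U) (r : Γ(X, U))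
    (φ : dualSections M U) :
    dualRestrict M h (r • φ) = (X.presheaf.map (homOfLE h).op r : Γ(X, W)) • dualRestrict M h φ := by
  ext V x
  change (X.presheaf.map (homOfLE (V.2.trans h)).op r : Γ(X, V.1)) •
      φ.1 ⟨V.1, V.2.trans h⟩ x =
    (X.presheaf.map (homOfLE V.2).op (X.presheaf.map (homOfLE h).op r) : Γ(X, V.1)) •
      φ.1 ⟨V.1, V.2.trans h⟩ x
  rw [← CategoryTheory.comp_apply, ← Functor.map_comp]
  rfl

/-- The underlying presheaf of abelian groups of the dual. -/
def dualPresheafAb (M : X.Modules) : X.Opensᵒᵖ ⥤ Ab.{u} where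
  obj U := .of (dualSections M U.unop)
  map f := AddCommGrpCat.ofHom (dualRestrict M f.unop.le)
  map_id _ := rfl
  map_comp _ _ := rfl

instance (M : X.Modules) (U : X.Opensᵒᵖ) :
    Module (X.ringCatSheaf.obj.obj U) ((dualPresheafAb M).obj U) :=
  inferInstanceAs (Module Γ(X, U.unop) (dualSections M U.unop))

/-- The dual `M^∨ = ℋom(M, 𝒪_X)`, as a presheaf of `𝒪_X`-modules. -/
def dual (M : X.Modules) : X.PresheafOfModules :=
  PresheafOfModules.ofPresheaf (dualPresheafAb M) (fun _ _ f r φ =>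
    dualRestrict_smul M f.unop.le r φ)

/-- The tensor product over `𝒪_X` of two (pre)sheaves of modules: the sheaf associated to
`U ↦ P(U) ⊗ Q(U)`. -/
def tensor (P Q : X.PresheafOfModules) : X.Modules :=
  (PresheafOfModules.sheafification (𝟙 X.ringCatSheaf.obj)).obj
    (PresheafOfModules.Monoidal.tensorObj (R := X.presheaf) P Q)

/-- `M` is globally generated: some family of global sections defines an epimorphism from a free
module onto `M`. -/
def IsGloballyGenerated (M : X.Modules) : Prop :=
  Nonempty (SheafOfModules.GeneratingSections (R := X.ringCatSheaf) M)

/-- The direct sum `M^a` of `a` copies of `M`. -/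
def power (M : X.Modules) (a : ℕ) : X.Modules :=
  ⨁ fun _ : Fin a => M

/-- `Ext^p(M, N) = 0`, in the abelian category of `𝒪_X`-modules. -/
def ExtVanishes (M N : X.Modules) (p : ℕ) : Prop :=
  letI : HasExt.{u + 1} X.Modules := HasExt.standard X.Modules
  Subsingleton (Abelian.Ext.{u + 1} M N p)

end Modules

/-! ### Simple and exceptional bundles, cokernel bundles -/

section Bundles

variable (κ : Type u) [Field κ] {X : Scheme.{u}} [X.Over (Spec (.of κ))]

/-- `M` is simple: `Hom(M, M) = κ`, that is, every endomorphism of `M` is multiplication by a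
unique scalar. -/
def IsSimple (M : X.Modules) : Prop :=
  Function.Bijective (fun c : κ => c • 𝟙 M)

/-- `M` is exceptional: it is simple and `Ext^p(M, M) = 0` for all `p ≥ 1`. -/
structure IsExceptional (M : X.Modules) : Prop where
  simple : IsSimple κ M
  ext : ∀ p : ℕ, 1 ≤ p → ExtVanishes M M p

/-- The conditions imposed on the pair `(E, F)` in the definition of a cokernel bundle of type
`(E, F)`. (The last one includes that `Hom(E, F)` is finite dimensional, as `finrank` is `0`
otherwise.) -/
structure IsAdmissiblePair (E F : X.Modules) : Prop where
  simple_left : IsSimple κ E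
  simple_right : IsSimple κ F
  hom_eq_zero : ∀ f : F ⟶ E, f = 0
  ext_one : ExtVanishes F E 1
  globallyGenerated : IsGloballyGenerated (tensor (dual E) F.val)
  three_le_finrank : 3 ≤ Module.finrank κ (E ⟶ F)

/-- `C` is a vector bundle with a resolution `0 ⟶ E^a ⟶ F^b ⟶ C ⟶ 0`. -/
structure HasResolution (E F : X.Modules) (a b : ℕ) (C : X.Modules) : Prop where
  isVectorBundle : ∃ r : ℕ, IsVectorBundleOfRank C r
  exact : ∃ (α : power E a ⟶ power F b) (π : power F b ⟶ C) (zero : α ≫ π = 0),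
    (ShortComplex.mk α π zero).ShortExact

end Bundles

end CokernelBundles

end

universe v₁ u₁ w₁ k₁

namespace CokernelBundles

/-! ### Dimensions of Hom spaces between direct sums in a linear category. -/

section LinearCategory

variable {𝒞 : Type u₁} [Category.{v₁} 𝒞] [Preadditive 𝒞] {k : Type k₁} [Field k] [Linear k 𝒞]

/-! The identity is rank-nullity for `commutatorMap` at `α : E^a ⟶ F^b`, a linear map from `End(E^a)
× End(F^b)`, of dimension `a² + b²`, to `Hom(E^a, F^b)`, of dimension `w a b`. It is the
infinitesimal action of the automorphisms of the two terms on `α`. Rigidity of `C` makes it onto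
(`commutatorMap_surjective`). Simplicity of `C` makes its kernel the line of scalars
(`finrank_ker_commutatorMap`). The argument takes place in any `k`-linear abelian category; no
geometry enters. -/

lemma finrank_end_eq_one {M : 𝒞} (h : Function.Bijective (fun c : k => c • 𝟙 M)) :
    Module.finrank k (M ⟶ M) = 1 :=
  (LinearEquiv.ofBijective (LinearMap.toSpanSingleton k (M ⟶ M) (𝟙 M)) h).finrank_eq.symm.trans
    (Module.finrank_self k)

/-- For `α : P ⟶ Q`, the map `(A, B) ↦ α ≫ B - A ≫ α`, whose kernel is the space of endomorphisms
of the two-term complex `α`. -/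
def commutatorMap (k : Type k₁) [Field k] [Linear k 𝒞] {P Q : 𝒞} (α : P ⟶ Q) :
    (P ⟶ P) × (Q ⟶ Q) →ₗ[k] (P ⟶ Q) :=
  (Linear.leftComp k Q α).comp (LinearMap.snd k _ _) -
    (Linear.rightComp k P α).comp (LinearMap.fst k _ _)

lemma commutatorMap_apply {P Q : 𝒞} (α : P ⟶ Q) (x : (P ⟶ P) × (Q ⟶ Q)) :
    commutatorMap k α x = α ≫ x.2 - x.1 ≫ α :=
  rfl

variable [HasFiniteBiproducts 𝒞]

/-- Morphisms between finite direct sums are matrices of morphisms, linearly. -/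
noncomputable def biproductMatrixLinearEquiv (k : Type k₁) [Field k] [Linear k 𝒞] {I J : Type} [Finite I] [Finite J] (M : I → 𝒞) (N : J → 𝒞) :
    (⨁ M ⟶ ⨁ N) ≃ₗ[k] (∀ i j, M i ⟶ N j) :=
  { biproduct.matrixEquiv with
    map_add' := fun f g => by
      funext i j
      simp [biproduct.components]
    map_smul' := fun c f => by
      funext i j
      simp [biproduct.components] }

lemma finite_hom_biproduct {M N : 𝒞} (a b : ℕ) [Module.Finite k (M ⟶ N)] :
    Module.Finite k ((⨁ fun _ : Fin a => M) ⟶ ⨁ fun _ : Fin b => N) :=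
  Module.Finite.equiv (biproductMatrixLinearEquiv k _ _).symm

lemma finrank_hom_biproduct (M N : 𝒞) (a b : ℕ) [Module.Finite k (M ⟶ N)] :
    Module.finrank k ((⨁ fun _ : Fin a => M) ⟶ ⨁ fun _ : Fin b => N) =
      a * (b * Module.finrank k (M ⟶ N)) := by
  rw [(biproductMatrixLinearEquiv k _ _).finrank_eq, Module.finrank_pi_fintype]
  simp [Module.finrank_pi_fintype]

end LinearCategory

/-! ### Rigidity and simplicity of the cokernel, and the dimension count. -/

section AbelianCategory

variable {𝒞 : Type u₁} [Category.{v₁} 𝒞] [Abelian 𝒞]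

section Ext

variable [HasExt.{w₁} 𝒞]

lemma subsingleton_ext_biproduct {I J : Type} [Fintype I] [Fintype J] (M : I → 𝒞) (N : J → 𝒞)
    [HasBiproduct M] [HasBiproduct N] (n : ℕ)
    (h : ∀ i j, Subsingleton (Abelian.Ext.{w₁} (M i) (N j) n)) :
    Subsingleton (Abelian.Ext.{w₁} (⨁ M) (⨁ N) n) := by
  have h' (i : I) : Subsingleton (Abelian.Ext.{w₁} (M i) (⨁ N) n) :=
    (Abelian.Ext.addEquivBiproduct (M i) (biproduct.isBilimit N) n).toEquiv.subsingleton
  exact (Abelian.Ext.biproductAddEquiv (biproduct.isBilimit M) (⨁ N) n).toEquiv.subsingleton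

/-- If `Ext¹(S.X₃, Y) = 0`, then every morphism `S.X₁ ⟶ Y` extends to `S.X₂`. -/
lemma exists_extension {S : ShortComplex 𝒞} (hS : S.ShortExact) {Y : 𝒞}
    [Subsingleton (Abelian.Ext.{w₁} S.X₃ Y 1)] (f : S.X₁ ⟶ Y) : ∃ g : S.X₂ ⟶ Y, S.f ≫ g = f := by
  -- The obstruction to extending `f` is its image under the connecting map to `Ext¹(S.X₃, Y) = 0`.
  obtain ⟨x, hx⟩ := Abelian.Ext.contravariant_sequence_exact₁ hS Y (Abelian.Ext.mk₀ f)
    (add_zero 1) (Subsingleton.elim _ _)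
  obtain ⟨g, rfl⟩ := Abelian.Ext.addEquiv₀.symm.surjective x
  exact ⟨g, (Abelian.Ext.mk₀_bijective _ _).injective
    (by simpa [Abelian.Ext.mk₀_comp_mk₀] using hx)⟩

/-- If `Ext¹(Y, S.X₁) = 0`, then every morphism `Y ⟶ S.X₃` lifts to `S.X₂`. -/
lemma exists_lifting {S : ShortComplex 𝒞} (hS : S.ShortExact) {Y : 𝒞}
    [Subsingleton (Abelian.Ext.{w₁} Y S.X₁ 1)] (f : Y ⟶ S.X₃) : ∃ g : Y ⟶ S.X₂, g ≫ S.g = f := by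
  obtain ⟨x, hx⟩ := Abelian.Ext.covariant_sequence_exact₃ Y hS (Abelian.Ext.mk₀ f)
    (zero_add 1) (Subsingleton.elim _ _)
  obtain ⟨g, rfl⟩ := Abelian.Ext.addEquiv₀.symm.surjective x
  exact ⟨g, (Abelian.Ext.mk₀_bijective _ _).injective
    (by simpa [Abelian.Ext.mk₀_comp_mk₀] using hx)⟩

end Ext

variable {k : Type k₁} [Field k] [Linear k 𝒞]

/-- The two Ext groups are successive obstructions: the first to extending `f ≫ S.g` to `S.X₂`, the
second to lifting that extension to an endomorphism `B`. Then `S.f ≫ B` and `f` agree modulo `S.X₁`,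
and their difference supplies `A`. -/
lemma commutatorMap_surjective [HasExt.{w₁} 𝒞] {S : ShortComplex 𝒞} (hS : S.ShortExact)
    [Subsingleton (Abelian.Ext.{w₁} S.X₃ S.X₃ 1)] [Subsingleton (Abelian.Ext.{w₁} S.X₂ S.X₁ 1)] :
    Function.Surjective (commutatorMap k S.f) := by
  intro f
  have := hS.mono_f
  obtain ⟨g, hg⟩ := exists_extension hS (f ≫ S.g)
  obtain ⟨B, hB⟩ := exists_lifting hS g
  have h : (S.f ≫ B - f) ≫ S.g = 0 := by simp [hB, hg]
  refine ⟨(hS.exact.lift _ h, B), ?_⟩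
  rw [commutatorMap_apply, hS.exact.lift_f, sub_sub_cancel]

/-- A kernel element is an endomorphism of the complex `S.f`, hence induces one of `S.X₃`, which is
a scalar. Since `Hom(S.X₂, S.X₁) = 0` there are no homotopies, so the induced scalar determines the
pair. -/
lemma finrank_ker_commutatorMap {S : ShortComplex 𝒞} (hS : S.ShortExact)
    (hsimple : Function.Bijective (fun c : k => c • 𝟙 S.X₃)) (hzero : ∀ f : S.X₂ ⟶ S.X₁, f = 0) :
    Module.finrank k (LinearMap.ker (commutatorMap k S.f)) = 1 := by
  have := hS.mono_f
  have := hS.epi_g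
  let e : LinearMap.ker (commutatorMap k S.f) :=
    ⟨(𝟙 _, 𝟙 _), by rw [LinearMap.mem_ker, commutatorMap_apply]; simp⟩
  refine finrank_eq_one e (fun he => ?_) ?_
  · have h₂ : 𝟙 S.X₂ = 0 := congrArg (fun x => x.1.2) he
    have h₃ : 𝟙 S.X₃ = 0 := by
      rw [← cancel_epi S.g, Category.comp_id, comp_zero, ← Category.id_comp S.g, h₂, zero_comp]
    -- Uniqueness of the scalar rules out `S.X₃ = 0`.
    exact one_ne_zero (hsimple.injective (show (1 : k) • 𝟙 S.X₃ = (0 : k) • 𝟙 S.X₃ by simp [h₃]))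
  · rintro ⟨⟨A, B⟩, hAB⟩
    replace hAB : S.f ≫ B = A ≫ S.f := sub_eq_zero.1 (LinearMap.mem_ker.1 hAB)
    have hB : S.f ≫ B ≫ S.g = 0 := by rw [reassoc_of% hAB, S.zero, comp_zero]
    obtain ⟨c, hc⟩ := hsimple.surjective (hS.exact.desc _ hB)
    have hg : (B - c • 𝟙 _) ≫ S.g = 0 := by
      have := hS.exact.g_desc _ hB
      rw [← hc] at this
      simp [← this]
    -- `B - c` lands in the kernel of `S.g`, so it factors through a morphism `S.X₂ ⟶ S.X₁`, which
    -- is zero.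
    have hBc : B = c • 𝟙 _ := by
      rw [← sub_eq_zero, ← hS.exact.lift_f _ hg, hzero (hS.exact.lift _ hg), zero_comp]
    have hAc : A = c • 𝟙 _ := by
      rw [← cancel_mono S.f, ← hAB, hBc]
      simp
    exact ⟨c, Subtype.ext (Prod.ext hAc.symm hBc.symm)⟩

/-- The numerical identity satisfied by a rigid simple object `S.X₃` with a resolution by direct
sums of two simple objects `M`, `N` such that `Hom(N, M) = Ext¹(N, M) = 0`. -/
lemma sq_add_sq_eq_of_shortExact [HasExt.{w₁} 𝒞] {M N C : 𝒞} {a b : ℕ}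
    (hM : Function.Bijective (fun c : k => c • 𝟙 M))
    (hN : Function.Bijective (fun c : k => c • 𝟙 N))
    (hC : Function.Bijective (fun c : k => c • 𝟙 C))
    (hNM : ∀ f : N ⟶ M, f = 0) (hext : Subsingleton (Abelian.Ext.{w₁} N M 1))
    (hCC : Subsingleton (Abelian.Ext.{w₁} C C 1)) [Module.Finite k (M ⟶ N)]
    [HasFiniteBiproducts 𝒞]
    {α : (⨁ fun _ : Fin a => M) ⟶ ⨁ fun _ : Fin b => N} {π : (⨁ fun _ : Fin b => N) ⟶ C}
    {zero : α ≫ π = 0} (hS : (ShortComplex.mk α π zero).ShortExact) :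
    a ^ 2 + b ^ 2 = Module.finrank k (M ⟶ N) * a * b + 1 := by
  have hM₁ := finrank_end_eq_one hM
  have hN₁ := finrank_end_eq_one hN
  -- `finrank` is `0` on infinite-dimensional spaces, so the value `1` forces finiteness.
  have : Module.Finite k (M ⟶ M) := Module.finite_of_finrank_eq_succ hM₁
  have : Module.Finite k (N ⟶ N) := Module.finite_of_finrank_eq_succ hN₁
  have := finite_hom_biproduct (k := k) (M := M) (N := M) a a
  have := finite_hom_biproduct (k := k) (M := N) (N := N) b b
  have : Subsingleton (Abelian.Ext.{w₁} (⨁ fun _ : Fin b => N) (⨁ fun _ : Fin a => M) 1) :=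
    subsingleton_ext_biproduct _ _ 1 fun _ _ => hext
  have hrange := LinearMap.range_eq_top.2 (commutatorMap_surjective (k := k) hS)
  have hker := finrank_ker_commutatorMap hS hC fun f => by
    refine biproduct.hom_ext _ _ fun j => biproduct.hom_ext' _ _ fun i => ?_
    exact (hNM _).trans (hNM _).symm
  have h := LinearMap.finrank_range_add_finrank_ker (commutatorMap k α)
  rw [hrange, finrank_top, hker, Module.finrank_prod, finrank_hom_biproduct, finrank_hom_biproduct,
    finrank_hom_biproduct, hM₁, hN₁] at h
  linarith

end AbelianCategory

end CokernelBundles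

theorem proposition3p11 {κ : Type u} [Field κ] [IsAlgClosed κ] [CharZero κ]
    {X : Scheme.{u}} [X.Over (Spec (.of κ))]
    (hX : CokernelBundles.IsNonsingularProjectiveVariety κ X)
    (n : ℕ) (hdim : topologicalKrullDim X = n) (hn : 2 ≤ n)
    (E F : X.Modules) (rE rF : ℕ)
    (hE : CokernelBundles.IsVectorBundleOfRank E rE)
    (hF : CokernelBundles.IsVectorBundleOfRank F rF)
    (hEF : CokernelBundles.IsAdmissiblePair κ E F)
    (C : X.Modules) (a b : ℕ)
    (hC : CokernelBundles.HasResolution E F a b C)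
    (hrank : (n : ℤ) ≤ b * rF - a * rE)
    (hexc : CokernelBundles.IsExceptional κ C) :
    (a : ℤ) ^ 2 + (b : ℤ) ^ 2 - (Module.finrank κ (E ⟶ F) : ℤ) * a * b = 1 := by
  obtain ⟨α, π, zero, hS⟩ := hC.exact
  -- The same choice of `Ext` as inside `ExtVanishes`, so that the vanishing hypotheses apply as
  -- they stand.
  let _ : HasExt.{u + 1} X.Modules := HasExt.standard X.Modules
  have : Module.Finite κ (E ⟶ F) :=
    Module.finite_of_finrank_pos (by have := hEF.three_le_finrank; omega)
  have : HasFiniteBiproducts X.Modules := Abelian.hasFiniteBiproducts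
  have h := CokernelBundles.sq_add_sq_eq_of_shortExact (k := κ) hEF.simple_left hEF.simple_right
    hexc.simple hEF.hom_eq_zero hEF.ext_one (hexc.ext 1 le_rfl) hS
  zify at h
  linarith
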